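/- Let $(X,d)$ be a compact connected metric space with more than one point, and let $\mu$ be a finite Borel measure on $X$ of full support (every ball of positive radius has positive measure). Write $B_r(x)$ and $B_r[x]$ for open and closed balls. For $r>0$ and a weight $g:X\to(0,\infty)$ put $$N_{r,g}(x)=\frac1{\mu(B_r(x))}\int_{B_r(x)}\Big(1+\frac{g(x)}{g(y)}\Big)d\mu(y),\qquad s_{r,g}(x,y)=\frac{1}{N_{r,g}(x)\,\mu(B_r(x))}\,\chi_{B_r(x)}(y)\Big(1+\frac{g(x)}{g(y)}\Big).$$ *Local time exponent.* Let $v_r(x)=\mu(B_r(x))$ and consider the discrete time Markov chain on $X$ with transition density $w_r=s_{r,v_r}$ with respect to $\mu$. For $B=B_R[x_0]$ let $E_{B,r}(x)\in[0,\infty]$ be the expectation of the first exit time $\inf\{k\ge 0: \text{the chain is outside } B \text{ at time } k\}$ for the chain started at $x$, and let $E^+_{r,B}=\sup_{y\in B}E_{B,r}(y)$. For $\gamma\ge 0$ let $T_\gamma(B)=\limsup_{r\to0^+}E^+_{r,B}\,r^\gamma$, and let $\beta(B)=\sup\{\gamma\ge 0: T_\gamma(B)=\infty\}\in[0,\infty]$.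 The local time exponent is $\beta(x)=\inf_{R>0}\beta(B_R[x])$. *Variable time regularity.* Suppose $\beta(x)<\infty$ for all $x$. Let $\tau_r(x)=r^{\beta(x)}$ and $d_r(x)=\mu(B_r(x))\,r^{\beta(x)}$, and consider the continuous time pure jump process on $X$ which waits at a site $x$ an exponential time of mean $\tau_r(x)$ and then jumps with density $p_r(x,\cdot)=s_{r,d_r}(x,\cdot)$ with respect to $\mu$. For $B=B_R[x_0]$ let $\phi_{r,B}(x)$ be the expectation of its first exit time from $B$ when it starts at $x$, and let $\mathcal T(B)=\limsup_{r\to0^+}\sup_{y\in B}\phi_{r,B}(y)$. The space $(X,d,\mu)$ is variable time regular with exponent $\beta(\cdot)$ if there is $C>0$ such that for all $x\in X$ and $0<R<\operatorname{diam}(X)/2$ $$\tfrac1C\,R^{\beta(x)}\le \mathcal T(B_R[x])\le C\,R^{\beta(x)}.$$ The measure $\mu$ is doubling if there is $C>0$ such that $0<\mu(B_{2r}(x))\le C\mu(B_r(x))$ for all $x\in X$ and $0<r<\operatorname{diam}(X)$. **Theorem.** Suppose $\mu$ is doubling and $(X,d,\mu)$ is variable time regular with exponent $\beta(\cdot)$,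 the local time exponent. Then $\beta(x)\ge 2$ for all $x\in X$. -/

import Mathlib

open MeasureTheory ProbabilityTheory Filter Topology Set
open scoped ENNReal NNReal

namespace TimeExponent

noncomputable section

/-! ### Path space of a time-homogeneous Markov chain -/

open Classical in
/-- The law `ℙ^x` on `ℕ → S` of the time-homogeneous Markov chain with transition kernel `κ`
started at `x` (Ionescu-Tulcea). It is meant for Markov kernels only; the kernels used below are
proved to be Markov at the end of this file. -/
def pathLaw {S : Type*} [MeasurableSpace S] (κ : Kernel S S) (x : S) : Measure (ℕ → S) :=
  if h : IsMarkovKernel κ then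
    haveI := h
    Kernel.traj (X := fun _ : ℕ => S)
      (fun n => κ.comap (fun p : (i : Finset.Iic n) → S => p ⟨n, Finset.mem_Iic.2 le_rfl⟩)
        (measurable_pi_apply _)) 0 (fun _ => x)
  else 0

/-- First exit time `inf {k ≥ 0 | ω k ∉ A}` of a discrete path, with `inf ∅ = ∞`. -/
def exitTime {X : Type*} (A : Set X) (ω : ℕ → X) : ℝ≥0∞ :=
  ⨅ (k : ℕ) (_ : ω k ∉ A), (k : ℝ≥0∞)

/-- Position at time `t` of the pure jump path that is at `(ω k).2` after its `k`-th jump and whose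
`k`-th jump comes after a waiting time `(ω k).1`: it is `(ω k).2` for
`k = sup {k | ∑_{j ≤ k} (ω j).1 ≤ t}`. -/
def jumpPosition {X : Type*} (ω : ℕ → ℝ × X) (t : ℝ) : X :=
  (ω (sSup {k : ℕ | ∑ j ∈ Finset.range (k + 1), (ω j).1 ≤ t})).2

/-- First exit time `inf {t ≥ 0 | x_t ∉ A}` of the pure jump path. -/
def jumpExitTime {X : Type*} (A : Set X) (ω : ℕ → ℝ × X) : ℝ≥0∞ :=
  ⨅ (t : ℝ) (_ : 0 ≤ t) (_ : jumpPosition ω t ∉ A), ENNReal.ofReal t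

section Walks

variable {X : Type*} [MetricSpace X] [MeasurableSpace X]

/-- A doubling measure. -/
def IsDoubling (μ : Measure X) : Prop :=
  ∃ C : ℝ≥0, ∀ (x : X) (r : ℝ), 0 < r → r < Metric.diam (univ : Set X) →
    0 < μ (Metric.ball x (2 * r)) ∧ μ (Metric.ball x (2 * r)) ≤ C * μ (Metric.ball x r)

/-- `v_r(x) = μ(B_r(x))`. -/
def vol (μ : Measure X) (r : ℝ) (x : X) : ℝ≥0∞ := μ (Metric.ball x r)

/-- The normalisation `(1 / μ(B_r(x))) ∫_{B_r(x)} (1 + g(x) / g(y)) dμ(y)` for a weight `g`. -/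
def stepNorm (μ : Measure X) (r : ℝ) (g : X → ℝ≥0∞) (x : X) : ℝ≥0∞ :=
  (vol μ r x)⁻¹ * ∫⁻ y in Metric.ball x r, (1 + g x / g y) ∂μ

/-- The transition density with respect to `μ` of the partially symmetrised `r`-step walk with
weight `g`: the walk jumps from `x` to `y ∈ B_r(x)` with density proportional to
`1 + g(x) / g(y)`. -/
def stepDensity (μ : Measure X) (r : ℝ) (g : X → ℝ≥0∞) (x y : X) : ℝ≥0∞ :=
  (stepNorm μ r g x)⁻¹ * (vol μ r x)⁻¹ * (Metric.ball x r).indicator (fun y => 1 + g x / g y) y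

/-! ### The discrete walk and the local time exponent -/

/-- The Markov kernel `W_r` of the partially symmetrised walk (weight `v_r`). -/
def stepKernel (μ : Measure X) [IsFiniteMeasure μ] (r : ℝ) : Kernel X X :=
  (Kernel.const X μ).withDensity (stepDensity μ r (vol μ r))

/-- Mean exit time `E_{A,r}(x)` of the discrete walk from `A`, started at `x`. -/
def meanExit (μ : Measure X) [IsFiniteMeasure μ] (r : ℝ) (A : Set X) (x : X) : ℝ≥0∞ :=
  ∫⁻ ω, exitTime A ω ∂(pathLaw (stepKernel μ r) x)

/-- `E⁺_{r,A} = sup_{y ∈ A} E_{A,r}(y)`. -/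
def maxMeanExit (μ : Measure X) [IsFiniteMeasure μ] (r : ℝ) (A : Set X) : ℝ≥0∞ :=
  ⨆ y ∈ A, meanExit μ r A y

/-- `T_γ(A) = limsup_{r → 0⁺} E⁺_{r,A} r^γ`. -/
def scaledExit (μ : Measure X) [IsFiniteMeasure μ] (γ : ℝ≥0) (A : Set X) : ℝ≥0∞ :=
  limsup (fun r : ℝ => maxMeanExit μ r A * ENNReal.ofReal (r ^ (γ : ℝ))) (𝓝[>] (0 : ℝ))

/-- The critical exponent `β(A) = sup {γ ≥ 0 | T_γ(A) = ∞}`. -/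
def exitExponent (μ : Measure X) [IsFiniteMeasure μ] (A : Set X) : ℝ≥0∞ :=
  ⨆ (γ : ℝ≥0) (_ : scaledExit μ γ A = ∞), (γ : ℝ≥0∞)

/-- The local time exponent `β(x) = inf_{R > 0} β(B_R[x])`. -/
def localTimeExponent (μ : Measure X) [IsFiniteMeasure μ] (x : X) : ℝ≥0∞ :=
  ⨅ (R : ℝ) (_ : 0 < R), exitExponent μ (Metric.closedBall x R)

/-! ### The time-renormalised walk and variable time regularity -/

/-- The waiting time `τ_r(x) = r^{β(x)}`. -/
def waitTime (β : X → ℝ≥0) (r : ℝ) (x : X) : ℝ := r ^ (β x : ℝ)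

/-- `d_r(x) = μ(B_r(x)) r^{β(x)}`. -/
def timeVol (μ : Measure X) (β : X → ℝ≥0) (r : ℝ) (x : X) : ℝ≥0∞ :=
  vol μ r x * ENNReal.ofReal (waitTime β r x)

/-- The kernel on pairs (waiting time, site) of the renormalised walk: from the site `x` it waits an
exponential time of mean `τ_r(x)` and then jumps with the density `p_r(x, ·)`, which is the step
density for the weight `d_r`. -/
def jumpKernel (μ : Measure X) [IsFiniteMeasure μ] (β : X → ℝ≥0) (r : ℝ) :
    Kernel (ℝ × X) (ℝ × X) :=
  (Kernel.const (ℝ × X) ((volume : Measure ℝ).prod μ)).withDensity fun a b =>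
    exponentialPDF (waitTime β r a.2)⁻¹ b.1 * stepDensity μ r (timeVol μ β r) a.2 b.2

/-- Mean exit time `φ_{r,A}(x)` of the renormalised continuous time walk from `A`. -/
def meanJumpExit (μ : Measure X) [IsFiniteMeasure μ] (β : X → ℝ≥0) (r : ℝ) (A : Set X) (x : X) :
    ℝ≥0∞ :=
  ∫⁻ ω, jumpExitTime A ω ∂(pathLaw (jumpKernel μ β r) (0, x))

/-- `𝒯(A) = limsup_{r → 0⁺} sup_{y ∈ A} φ_{r,A}(y)`. -/
def limitExit (μ : Measure X) [IsFiniteMeasure μ] (β : X → ℝ≥0) (A : Set X) : ℝ≥0∞ :=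
  limsup (fun r : ℝ => ⨆ y ∈ A, meanJumpExit μ β r A y) (𝓝[>] (0 : ℝ))

/-- The space is variable time regular with exponent `β`: `β` is the local time exponent (which
therefore is finite everywhere) and `𝒯(B_R[x])` is comparable with `R^{β(x)}`. -/
def IsVariableTimeRegular (μ : Measure X) [IsFiniteMeasure μ] (β : X → ℝ≥0) : Prop :=
  (∀ x, localTimeExponent μ x = β x) ∧
  ∃ C : ℝ, 0 < C ∧ ∀ (x : X) (R : ℝ), 0 < R → R < Metric.diam (univ : Set X) / 2 →
    ENNReal.ofReal (C⁻¹ * R ^ (β x : ℝ)) ≤ limitExit μ β (Metric.closedBall x R) ∧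
    limitExit μ β (Metric.closedBall x R) ≤ ENNReal.ofReal (C * R ^ (β x : ℝ))

end Walks

/-! ### The kernels are Markov kernels -/

section Facts

set_option linter.unusedSectionVars false

variable {X : Type*} [MetricSpace X] [MeasurableSpace X] [BorelSpace X] [CompactSpace X]

theorem lowerSemicontinuous_vol (μ : Measure X) (r : ℝ) : LowerSemicontinuous (vol μ r) := by
  intro x t ht
  have hU : Metric.ball x r = ⋃ n : ℕ, Metric.ball x (r - 1 / ((n : ℝ) + 1)) := by
    ext z
    simp only [Metric.mem_ball, mem_iUnion]
    constructor
    · intro hz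
      obtain ⟨n, hn⟩ := exists_nat_one_div_lt (sub_pos.2 hz)
      exact ⟨n, by linarith⟩
    · rintro ⟨n, hn⟩
      have : (0 : ℝ) < 1 / ((n : ℝ) + 1) := by positivity
      linarith
  have hmono : Monotone fun n : ℕ => Metric.ball x (r - 1 / ((n : ℝ) + 1)) := by
    intro m n hmn
    apply Metric.ball_subset_ball
    have : (1 : ℝ) / ((n : ℝ) + 1) ≤ 1 / ((m : ℝ) + 1) := by
      apply one_div_le_one_div_of_le (by positivity)
      have : (m : ℝ) ≤ n := by exact_mod_cast hmn
      linarith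
    linarith
  have ht' : t < ⨆ n : ℕ, μ (Metric.ball x (r - 1 / ((n : ℝ) + 1))) := by
    rw [← hmono.measure_iUnion, ← hU]
    exact ht
  obtain ⟨n, hn⟩ := lt_iSup_iff.1 ht'
  have hpos : (0 : ℝ) < 1 / ((n : ℝ) + 1) := by positivity
  filter_upwards [Metric.ball_mem_nhds x hpos] with y hy
  refine hn.trans_le (measure_mono ?_)
  intro z hz
  rw [Metric.mem_ball] at *
  have := dist_triangle z x y
  rw [dist_comm x y] at this
  linarith

theorem measurable_vol (μ : Measure X) (r : ℝ) : Measurable (vol μ r) :=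
  (lowerSemicontinuous_vol μ r).measurable

theorem vol_lt_top (μ : Measure X) [IsFiniteMeasure μ] (r : ℝ) (x : X) : vol μ r x < ∞ :=
  measure_lt_top _ _

theorem vol_pos (μ : Measure X) [μ.IsOpenPosMeasure] {r : ℝ} (hr : 0 < r) (x : X) :
    0 < vol μ r x :=
  Metric.measure_ball_pos μ x hr

theorem exists_le_vol (μ : Measure X) [μ.IsOpenPosMeasure] {r : ℝ}
    (hr : 0 < r) : ∃ c : ℝ≥0∞, c ≠ 0 ∧ ∀ x, c ≤ vol μ r x := by
  rcases isEmpty_or_nonempty X with h | h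
  · exact ⟨1, one_ne_zero, fun x => h.elim x⟩
  · obtain ⟨a, -, ha⟩ := ((lowerSemicontinuous_vol μ r).lowerSemicontinuousOn univ).exists_isMinOn
      univ_nonempty isCompact_univ
    exact ⟨vol μ r a, (vol_pos μ hr a).ne', fun x => ha (mem_univ x)⟩

theorem measurable_stepDensity (μ : Measure X) [IsFiniteMeasure μ] (r : ℝ) {g : X → ℝ≥0∞}
    (hg : Measurable g) : Measurable (Function.uncurry (stepDensity μ r g)) := by
  have hs : MeasurableSet {p : X × X | p.2 ∈ Metric.ball p.1 r} :=
    measurableSet_lt (measurable_snd.dist measurable_fst) measurable_const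
  have hq : Measurable fun p : X × X => 1 + g p.1 / g p.2 :=
    measurable_const.add ((hg.comp measurable_fst).div (hg.comp measurable_snd))
  have hi : Measurable fun p : X × X =>
      (Metric.ball p.1 r).indicator (fun y => 1 + g p.1 / g y) p.2 := hq.indicator hs
  have hn : Measurable (stepNorm μ r g) := by
    refine (measurable_vol μ r).inv.mul ?_
    have : Measurable fun x => ∫⁻ y, (Metric.ball x r).indicator (fun y => 1 + g x / g y) y ∂μ :=
      hi.lintegral_prod_right'
    simpa only [lintegral_indicator Metric.isOpen_ball.measurableSet] using this
  exact (((hn.comp measurable_fst).inv).mul (((measurable_vol μ r).comp measurable_fst).inv)).mul hi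

theorem lintegral_stepDensity (μ : Measure X) [IsFiniteMeasure μ] [μ.IsOpenPosMeasure] {r : ℝ}
    (hr : 0 < r) {g : X → ℝ≥0∞} (hg : Measurable g) {c : ℝ≥0∞} (hc : c ≠ 0)
    (hcg : ∀ x, c ≤ g x) (hgt : ∀ x, g x ≠ ∞) (x : X) :
    ∫⁻ y, stepDensity μ r g x y ∂μ = 1 := by
  have hm : Measurable fun y => 1 + g x / g y := measurable_const.add (measurable_const.div hg)
  have hv0 := (vol_pos μ hr x).ne'
  have hvt := (vol_lt_top μ r x).ne
  have hlow : vol μ r x ≤ ∫⁻ y in Metric.ball x r, (1 + g x / g y) ∂μ := by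
    calc vol μ r x = ∫⁻ y in Metric.ball x r, 1 ∂μ := by simp [vol]
      _ ≤ _ := lintegral_mono fun y => le_self_add
  have hup : ∫⁻ y in Metric.ball x r, (1 + g x / g y) ∂μ ≤ (1 + g x / c) * vol μ r x := by
    calc _ ≤ ∫⁻ _ in Metric.ball x r, (1 + g x / c) ∂μ := by
          refine lintegral_mono fun y => ?_
          gcongr
          exact hcg y
      _ = _ := by simp [vol]
  have hI0 : (∫⁻ y in Metric.ball x r, (1 + g x / g y) ∂μ) ≠ 0 :=
    ((vol_pos μ hr x).trans_le hlow).ne'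
  have hIt : (∫⁻ y in Metric.ball x r, (1 + g x / g y) ∂μ) ≠ ∞ := by
    refine ne_top_of_le_ne_top ?_ hup
    exact ENNReal.mul_ne_top
      (ENNReal.add_ne_top.2 ⟨ENNReal.one_ne_top, ENNReal.div_ne_top (hgt x) hc⟩) hvt
  have hN0 : stepNorm μ r g x ≠ 0 := mul_ne_zero (ENNReal.inv_ne_zero.2 hvt) hI0
  have hNt : stepNorm μ r g x ≠ ∞ := ENNReal.mul_ne_top (ENNReal.inv_ne_top.2 hv0) hIt
  unfold stepDensity
  rw [lintegral_const_mul _ (hm.indicator Metric.isOpen_ball.measurableSet),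
    lintegral_indicator Metric.isOpen_ball.measurableSet, mul_assoc]
  exact ENNReal.inv_mul_cancel hN0 hNt

/-- `W_r` is a Markov kernel. -/
theorem isMarkovKernel_stepKernel (μ : Measure X) [IsFiniteMeasure μ] [μ.IsOpenPosMeasure] {r : ℝ}
    (hr : 0 < r) : IsMarkovKernel (stepKernel μ r) := by
  obtain ⟨c, hc, hcv⟩ := exists_le_vol μ hr
  refine ⟨fun x => ⟨?_⟩⟩
  rw [stepKernel, Kernel.withDensity_apply' _ (measurable_stepDensity μ r (measurable_vol μ r)),
    setLIntegral_univ, Kernel.const_apply]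
  exact lintegral_stepDensity μ hr (measurable_vol μ r) hc hcv (fun x => (vol_lt_top μ r x).ne) x

theorem exitTime_mono {S : Type*} {A A' : Set S} (h : A ⊆ A') (ω : ℕ → S) :
    exitTime A ω ≤ exitTime A' ω :=
  iInf_mono fun _ => iInf_mono' fun hk => ⟨fun hk' => hk (h hk'), le_rfl⟩

theorem meanExit_mono (μ : Measure X) [IsFiniteMeasure μ] (r : ℝ) {A A' : Set X} (h : A ⊆ A')
    (x : X) : meanExit μ r A x ≤ meanExit μ r A' x :=
  lintegral_mono fun ω => exitTime_mono h ω

theorem exitExponent_mono (μ : Measure X) [IsFiniteMeasure μ] {A A' : Set X} (h : A ⊆ A') :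
    exitExponent μ A ≤ exitExponent μ A' := by
  have hE : ∀ r, maxMeanExit μ r A ≤ maxMeanExit μ r A' := fun r =>
    iSup₂_le fun y hy => (meanExit_mono μ r h y).trans
      (le_iSup₂ (f := fun y (_ : y ∈ A') => meanExit μ r A' y) y (h hy))
  refine iSup_mono fun γ => iSup_mono' fun hγ => ⟨?_, le_rfl⟩
  have : scaledExit μ γ A ≤ scaledExit μ γ A' :=
    limsup_le_limsup (Eventually.of_forall fun r => mul_le_mul_left (hE r) _)
  exact top_le_iff.1 (hγ ▸ this)

theorem upperSemicontinuous_localTimeExponent (μ : Measure X) [IsFiniteMeasure μ] :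
    UpperSemicontinuous (localTimeExponent μ) := by
  intro x t ht
  obtain ⟨R, hR⟩ := iInf_lt_iff.1 ht
  obtain ⟨hR0, hR⟩ := iInf_lt_iff.1 hR
  filter_upwards [Metric.ball_mem_nhds x (half_pos hR0)] with y hy
  refine lt_of_le_of_lt (iInf₂_le (R / 2) (half_pos hR0)) (lt_of_le_of_lt ?_ hR)
  refine exitExponent_mono μ (Metric.closedBall_subset_closedBall' ?_)
  rw [Metric.mem_ball] at hy
  linarith

/-- If `β` is the local time exponent, the kernel of the renormalised walk is a Markov kernel. -/
theorem isMarkovKernel_jumpKernel (μ : Measure X) [IsFiniteMeasure μ] [μ.IsOpenPosMeasure]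
    {β : X → ℝ≥0} (hβ : ∀ x, localTimeExponent μ x = β x) {r : ℝ} (hr : 0 < r) :
    IsMarkovKernel (jumpKernel μ β r) := by
  have husc : UpperSemicontinuous fun x => (β x : ℝ≥0∞) := by
    have := upperSemicontinuous_localTimeExponent μ
    rwa [show localTimeExponent μ = fun x => (β x : ℝ≥0∞) from funext hβ] at this
  have hβm : Measurable β := measurable_coe_nnreal_ennreal_iff.1 husc.measurable
  have hwm : Measurable (waitTime β r) :=
    measurable_const.pow (measurable_coe_nnreal_real.comp hβm)
  have hw0 : ∀ x, 0 < waitTime β r x := fun x => Real.rpow_pos_of_pos hr _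
  have hdm : Measurable (timeVol μ β r) := (measurable_vol μ r).mul hwm.ennreal_ofReal
  have hlow : ∃ c : ℝ≥0∞, c ≠ 0 ∧ ∀ x, c ≤ timeVol μ β r x := by
    obtain ⟨c, hc, hcv⟩ := exists_le_vol μ hr
    rcases isEmpty_or_nonempty X with h | h
    · exact ⟨1, one_ne_zero, fun x => h.elim x⟩
    obtain ⟨a, -, ha⟩ := (husc.upperSemicontinuousOn univ).exists_isMaxOn
      univ_nonempty isCompact_univ
    have hM : ∀ x, (β x : ℝ) ≤ β a := fun x => by
      have h1 : (β x : ℝ≥0∞) ≤ β a := ha (mem_univ x)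
      exact_mod_cast h1
    refine ⟨c * ENNReal.ofReal (min 1 (r ^ (β a : ℝ))),
      mul_ne_zero hc (ENNReal.ofReal_pos.2 (lt_min one_pos (Real.rpow_pos_of_pos hr _))).ne',
      fun x => mul_le_mul' (hcv x) (ENNReal.ofReal_le_ofReal ?_)⟩
    rcases le_total r 1 with h1 | h1
    · exact (min_le_right _ _).trans (Real.rpow_le_rpow_of_exponent_ge hr h1 (hM x))
    · exact (min_le_left _ _).trans (Real.one_le_rpow h1 (β x).2)
  obtain ⟨c, hc, hcd⟩ := hlow
  have hdt : ∀ x, timeVol μ β r x ≠ ∞ := fun x =>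
    ENNReal.mul_ne_top (vol_lt_top μ r x).ne ENNReal.ofReal_ne_top
  have hem : Measurable fun q : ℝ × ℝ => exponentialPDF q.1 q.2 := by
    simp_rw [exponentialPDF_eq]
    refine Measurable.ennreal_ofReal (Measurable.ite ?_ ?_ measurable_const)
    · exact measurableSet_le measurable_const measurable_snd
    · fun_prop
  have hsm := measurable_stepDensity μ r hdm
  have h1 : Measurable fun p : (ℝ × X) × ℝ × X => exponentialPDF (waitTime β r p.1.2)⁻¹ p.2.1 :=
    hem.comp (f := fun p : (ℝ × X) × ℝ × X => ((waitTime β r p.1.2)⁻¹, p.2.1)) (by fun_prop)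
  have h2 : Measurable fun p : (ℝ × X) × ℝ × X =>
      stepDensity μ r (timeVol μ β r) p.1.2 p.2.2 :=
    hsm.comp (f := fun p : (ℝ × X) × ℝ × X => (p.1.2, p.2.2)) (by fun_prop)
  have h12 : Measurable (Function.uncurry fun a b : ℝ × X =>
      exponentialPDF (waitTime β r a.2)⁻¹ b.1 * stepDensity μ r (timeVol μ β r) a.2 b.2) :=
    h1.mul h2
  refine ⟨fun a => ⟨?_⟩⟩
  have h3 : Measurable fun t : ℝ => exponentialPDF (waitTime β r a.2)⁻¹ t :=
    hem.comp (f := fun t : ℝ => ((waitTime β r a.2)⁻¹, t)) (by fun_prop)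
  have h4 : Measurable fun y : X => stepDensity μ r (timeVol μ β r) a.2 y :=
    hsm.comp (f := fun y : X => (a.2, y)) (by fun_prop)
  have h5 := lintegral_prod_mul (μ := (volume : Measure ℝ)) (ν := μ) h3.aemeasurable
    h4.aemeasurable
  rw [jumpKernel, Kernel.withDensity_apply' _ h12, setLIntegral_univ, Kernel.const_apply, h5,
    lintegral_exponentialPDF_eq_one (inv_pos.2 (hw0 _)),
    lintegral_stepDensity μ hr hdm hc hcd hdt, one_mul]

end Facts

end

end TimeExponent

namespace TimeExponent

noncomputable section

/-! ### Path integrals of a Markov chain -/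

section PathIntegrals

variable {S : Type*} [MeasurableSpace S] (κ : Kernel S S)

/-! With the weight `d_r`, the renormalised walk is reversible: its step density is `k(x, y) / ∫
k(x, ·)` for the symmetric kernel `k(x, y) = χ(1 / d_r(x) + 1 / d_r(y))`. If `β a < 2`, upper
semicontinuity of the local time exponent gives `β ≤ b < 2` on a small ball about `a`. A Lipschitz
bump there changes by at most `r` in one jump, and jumps occur at rate about `r ^ (-β)`, so its
energy is at most `r ^ (2 - b) * μ univ`, which tends to `0`.

Exit times bound the energy from below. The expected time `h` spent in a closed ball `A` before
leaving it satisfies `h = τ + P h` on `A`, hence `-L h ≥ 1` for the generator of the form with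
kernel `k`. Barta's inequality then gives `∫ f² ≤ (sup h) · energy(f)` for `f` supported in `A`.
Since `h` is at most the mean exit time, finiteness of the limit exit time bounds `sup h` for all
small `r` and forces `∫ f² = 0`, which is absurd for a bump.

The carrying lemmas are `greenTime_le_meanJumpExit`, `one_add_le_greenTime_mul`,
`lintegral_sq_le_mul_energy` and `energy_le`. -/

theorem map_pathLaw [IsMarkovKernel κ] (x : S) (n : ℕ) :
    ∃ ν : Measure ((i : Finset.Iic n) → S), SFinite ν ∧
      (pathLaw κ x).map (Preorder.frestrictLe (π := fun _ : ℕ => S) n) = ν ∧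
      (pathLaw κ x).map (fun ω => (Preorder.frestrictLe (π := fun _ : ℕ => S) n ω, ω (n + 1))) =
        ν ⊗ₘ κ.comap (fun p : (i : Finset.Iic n) → S => p ⟨n, Finset.mem_Iic.2 le_rfl⟩)
          (measurable_pi_apply _) := by
  have hM : IsMarkovKernel κ := inferInstance
  refine ⟨_, ?_, rfl, ?_⟩
  · simp only [pathLaw, dif_pos hM]
    infer_instance
  · simp only [pathLaw, dif_pos hM]
    rw [← Kernel.partialTraj_compProd_eq_map_traj (Nat.zero_le n),
      Kernel.traj_map_frestrictLe_apply]

/-- The Markov property in integrated form: conditionally on the first `n + 1` coordinates, the next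
one has law `κ (ω n)`. -/
theorem lintegral_pathLaw_succ [IsMarkovKernel κ] (x : S) (n : ℕ)
    {F : ((i : Finset.Iic n) → S) → ℝ≥0∞} (hF : Measurable F) {G : S → ℝ≥0∞}
    (hG : Measurable G) :
    ∫⁻ ω, F (Preorder.frestrictLe (π := fun _ : ℕ => S) n ω) * G (ω (n + 1)) ∂pathLaw κ x =
      ∫⁻ ω, F (Preorder.frestrictLe (π := fun _ : ℕ => S) n ω) * ∫⁻ b, G b ∂κ (ω n)
        ∂pathLaw κ x := by
  obtain ⟨ν, hν, h1, h2⟩ := map_pathLaw κ x n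
  have hFG : Measurable fun p : ((i : Finset.Iic n) → S) × S => F p.1 * G p.2 := by fun_prop
  have hKG : Measurable fun a => ∫⁻ b, G b ∂κ a := hG.lintegral_kernel
  have hm : Measurable (Preorder.frestrictLe (π := fun _ : ℕ => S) n) :=
    Preorder.measurable_frestrictLe n
  have hFK : Measurable fun p : (i : Finset.Iic n) → S =>
      F p * ∫⁻ b, G b ∂κ (p ⟨n, Finset.mem_Iic.2 le_rfl⟩) :=
    hF.mul (hKG.comp (measurable_pi_apply _))
  have e1 := lintegral_map (μ := pathLaw κ x) hFG (hm.prodMk (measurable_pi_apply (n + 1)))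
  have e2 := lintegral_map (μ := pathLaw κ x) hFK hm
  rw [h2, Measure.lintegral_compProd hFG] at e1
  rw [h1] at e2
  refine e1.symm.trans (Eq.trans ?_ e2)
  refine lintegral_congr fun p => ?_
  rw [Kernel.comap_apply]
  exact lintegral_const_mul (F p) hG

theorem lintegral_pathLaw_zero [IsMarkovKernel κ] (x : S) {G : S → ℝ≥0∞} (hG : Measurable G) :
    ∫⁻ ω, G (ω 0) ∂pathLaw κ x = G x := by
  have hM : IsMarkovKernel κ := inferInstance
  have hG0 : Measurable fun p : (i : Finset.Iic 0) → S => G (p ⟨0, Finset.mem_Iic.2 le_rfl⟩) :=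
    hG.comp (measurable_pi_apply _)
  have e := lintegral_map (μ := pathLaw κ x) hG0
    (Preorder.measurable_frestrictLe (X := fun _ : ℕ => S) 0)
  refine e.symm.trans ?_
  simp only [pathLaw, dif_pos hM]
  rw [Kernel.traj_map_frestrictLe_apply, Kernel.partialTraj_self, Kernel.id_apply,
    lintegral_dirac' _ hG0]

/-- The transition operator of a chain killed when it jumps from a point outside `A`. -/
def killedOp (A : Set S) (G : S → ℝ≥0∞) (a : S) : ℝ≥0∞ :=
  A.indicator (fun a => ∫⁻ b, G b ∂κ a) a

variable {κ} in
theorem measurable_killedOp {A : Set S} (hA : MeasurableSet A) {G : S → ℝ≥0∞}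
    (hG : Measurable G) : Measurable (killedOp κ A G) :=
  (hG.lintegral_kernel (κ := κ)).indicator hA

/-- The Markov property absorbs the last jump and its indicator into `killedOp κ A G`, so the
induction needs `G` arbitrary. The product stops before `n`: the endpoint itself may lie outside
`A`. -/
theorem lintegral_pathLaw_killed [IsMarkovKernel κ] {A : Set S} (hA : MeasurableSet A) (x : S)
    (n : ℕ) {G : S → ℝ≥0∞} (hG : Measurable G) :
    ∫⁻ ω, (∏ i ∈ Finset.range n, A.indicator 1 (ω i)) * G (ω n) ∂pathLaw κ x =
      (killedOp κ A)^[n] G x := by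
  induction n generalizing G with
  | zero => simpa using lintegral_pathLaw_zero κ x hG
  | succ n ih =>
    have hF : Measurable fun p : (i : Finset.Iic n) → S =>
        ∏ i : Finset.Iic n, A.indicator (1 : S → ℝ≥0∞) (p i) :=
      Finset.measurable_prod _ fun i _ =>
        (measurable_one.indicator hA).comp (measurable_pi_apply i)
    have hp : ∀ ω : ℕ → S, ∏ i : Finset.Iic n, A.indicator (1 : S → ℝ≥0∞) (ω i) =
        ∏ i ∈ Finset.range (n + 1), A.indicator 1 (ω i) := by
      intro ω
      rw [Finset.prod_coe_sort (Finset.Iic n) fun i => A.indicator (1 : S → ℝ≥0∞) (ω i)]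
      exact Finset.prod_congr (by ext; simp) fun _ _ => rfl
    have h := lintegral_pathLaw_succ κ x n hF hG
    simp only [Preorder.frestrictLe_apply, hp] at h
    rw [h, Function.iterate_succ_apply, ← ih (measurable_killedOp hA hG)]
    refine lintegral_congr fun ω => ?_
    rw [Finset.prod_range_succ, mul_assoc]
    by_cases hω : ω n ∈ A <;> simp [killedOp, hω]

theorem ae_pathLaw_succ [IsMarkovKernel κ] (x : S) {s : Set S} (hs : MeasurableSet s)
    (h : ∀ a, κ a s = 0) (n : ℕ) : ∀ᵐ ω ∂pathLaw κ x, ω (n + 1) ∉ s := by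
  have e := lintegral_pathLaw_succ κ x n (F := 1) measurable_one
    (measurable_one.indicator hs)
  simp only [lintegral_indicator_one hs, h, mul_zero, lintegral_zero, Pi.one_apply, one_mul] at e
  have e := (lintegral_eq_zero_iff
    ((measurable_one.indicator hs).comp (measurable_pi_apply (n + 1)))).1 e
  filter_upwards [e] with ω hω hs
  simp [hs] at hω

theorem ae_pathLaw_zero [IsMarkovKernel κ] (x : S) {s : Set S} (hs : MeasurableSet s)
    (h : x ∉ s) : ∀ᵐ ω ∂pathLaw κ x, ω 0 ∉ s := by
  have e := lintegral_pathLaw_zero κ x (measurable_one.indicator hs)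
  rw [indicator_of_notMem h] at e
  have e := (lintegral_eq_zero_iff
    ((measurable_one.indicator hs).comp (measurable_pi_apply 0))).1 e
  filter_upwards [e] with ω hω hs
  simp [hs] at hω

end PathIntegrals

/-! ### Lower bound for the exit time of a jump path -/

/-- The time held at site `(ω j).2` is `(ω (j + 1)).1`, and it is counted only while the sites `0,
…, j` all lie in `A`. If the path is outside `A` at time `t`, after `K` jumps, every term with `j ≥
K` vanishes and the others are holding times completed by time `t`. -/
theorem tsum_le_jumpExitTime {X : Type*} (A : Set X) {ω : ℕ → ℝ × X} (hω : ∀ j, 0 ≤ (ω j).1) :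
    ∑' j, (∏ i ∈ Finset.range (j + 1), (Prod.snd ⁻¹' A).indicator 1 (ω i)) *
      ENNReal.ofReal (ω (j + 1)).1 ≤ jumpExitTime A ω := by
  refine le_iInf fun t => le_iInf fun ht => le_iInf fun hA => ?_
  rw [jumpPosition] at hA
  set s : Set ℕ := {k : ℕ | ∑ j ∈ Finset.range (k + 1), (ω j).1 ≤ t} with hs
  have hz : ∀ j, sSup s ≤ j → (∏ i ∈ Finset.range (j + 1),
      (Prod.snd ⁻¹' A).indicator (1 : ℝ × X → ℝ≥0∞) (ω i)) * ENNReal.ofReal (ω (j + 1)).1 = 0 := by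
    intro j hj
    rw [Finset.prod_eq_zero (Finset.mem_range.2 (Nat.lt_succ_iff.2 hj)), zero_mul]
    exact indicator_of_notMem (s := Prod.snd ⁻¹' A) hA _
  rw [tsum_eq_sum (s := Finset.range (sSup s)) fun j hj =>
    hz j (not_lt.1 fun h => hj (Finset.mem_range.2 h))]
  -- `sSup` in `ℕ` is `0` for an empty or unbounded set, and then the sum is empty. Otherwise the
  -- supremum is attained.
  by_cases h0 : sSup s = 0
  · simp [h0]
  have hmem : sSup s ∈ s := by
    refine Nat.sSup_mem ?_ ?_
    · by_contra h
      rw [not_nonempty_iff_eq_empty] at h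
      simp [h] at h0
    · by_contra h
      exact h0 ((csSup_of_not_bddAbove h).trans csSup_empty)
  calc _ ≤ ∑ j ∈ Finset.range (sSup s), ENNReal.ofReal (ω (j + 1)).1 := by
        refine Finset.sum_le_sum fun j _ => mul_le_of_le_one_left' (Finset.prod_le_one' fun i _ => ?_)
        exact indicator_le_self' (fun _ _ => zero_le) _
    _ ≤ ∑ j ∈ Finset.range (sSup s + 1), ENNReal.ofReal (ω j).1 := by
        rw [Finset.sum_range_succ']
        exact le_self_add
    _ = ENNReal.ofReal (∑ j ∈ Finset.range (sSup s + 1), (ω j).1) :=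
        (ENNReal.ofReal_sum_of_nonneg fun j _ => hω j).symm
    _ ≤ ENNReal.ofReal t := ENNReal.ofReal_le_ofReal hmem

/-! ### Barta's inequality for a symmetric jump form -/

/-- AM-GM: the difference of the sides is `(a w - b u)² / (u w)`. Conditions on `u`, `w` are imposed
only where `a`, `b` do not vanish, as the supersolution is controlled only on the support of the
test function. -/
theorem two_mul_le_ground_state {a b : ℝ≥0} {u w : ℝ≥0∞} (hu : a ≠ 0 → u ≠ 0 ∧ u ≠ ∞)
    (hw : b ≠ 0 → w ≠ 0 ∧ w ≠ ∞) :
    2 * ((a : ℝ≥0∞) * b) ≤ (a : ℝ≥0∞) ^ 2 * (w / u) + (b : ℝ≥0∞) ^ 2 * (u / w) := by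
  by_cases ha : a = 0
  · simp [ha]
  by_cases hb : b = 0
  · simp [hb]
  obtain ⟨hu0, hut⟩ := hu ha
  obtain ⟨hw0, hwt⟩ := hw hb
  lift u to ℝ≥0 using hut
  lift w to ℝ≥0 using hwt
  have hu0 : u ≠ 0 := by simpa using hu0
  have hw0 : w ≠ 0 := by simpa using hw0
  rw [← ENNReal.coe_div hu0, ← ENNReal.coe_div hw0]
  norm_cast
  rw [← NNReal.coe_le_coe]
  push_cast
  have hu1 : (0 : ℝ) < u := by positivity
  have hw1 : (0 : ℝ) < w := by positivity
  have : (a : ℝ) ^ 2 * (w / u) + b ^ 2 * (u / w) - 2 * (a * b) = (a * w - b * u) ^ 2 / (u * w) := by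
    field_simp
    ring
  have h2 : (0 : ℝ) ≤ (a * w - b * u) ^ 2 / (u * w) := by positivity
  linarith

theorem sq_add_sq_eq (a b : ℝ≥0) :
    (a : ℝ≥0∞) ^ 2 + (b : ℝ≥0∞) ^ 2 =
      2 * ((a : ℝ≥0∞) * b) + ENNReal.ofReal (((a : ℝ) - b) ^ 2) := by
  simp only [← ENNReal.ofReal_coe_nnreal]
  rw [← ENNReal.ofReal_pow a.coe_nonneg, ← ENNReal.ofReal_pow b.coe_nonneg,
    ← ENNReal.ofReal_mul a.coe_nonneg,
    ← ENNReal.ofReal_add (by positivity) (by positivity),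
    show (2 : ℝ≥0∞) = ENNReal.ofReal 2 by simp, ← ENNReal.ofReal_mul (by norm_num),
    ← ENNReal.ofReal_add (by positivity) (by positivity)]
  congr 1
  ring

section GroundState

variable {X : Type*} [MeasurableSpace X] {μ : Measure X}

theorem lintegral_lintegral_add [SFinite μ] {f g : X → X → ℝ≥0∞}
    (hf : Measurable (Function.uncurry f)) :
    ∫⁻ x, ∫⁻ y, (f x y + g x y) ∂μ ∂μ =
      ∫⁻ x, ∫⁻ y, f x y ∂μ ∂μ + ∫⁻ x, ∫⁻ y, g x y ∂μ ∂μ := by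
  have h : Measurable fun x => ∫⁻ y, f x y ∂μ := hf.lintegral_prod_right'
  rw [← lintegral_add_left h]
  exact lintegral_congr fun x => lintegral_add_left (hf.comp measurable_prodMk_left) _

/-- If `h` is a positive supersolution of `-L h = 1` on the support of `f`, where `L` is the
generator of the jump form with the symmetric density `j(x, y) + j(y, x)`, then the `L²` norm of `f`
is controlled by its energy. -/
theorem lintegral_sq_le_mul_energy [IsFiniteMeasure μ] {j : X → X → ℝ≥0∞}
    (hj : Measurable (Function.uncurry j)) {c : ℝ≥0∞} (hc : c ≠ ∞) (hjc : ∀ x y, j x y ≤ c)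
    {f : X → ℝ≥0} (hf : Measurable f) {b : ℝ≥0} (hfb : ∀ x, f x ≤ b)
    {h : X → ℝ≥0∞} (hh : Measurable h) {M : ℝ≥0∞} (hM : M ≠ ∞)
    (hhM : ∀ x, f x ≠ 0 → h x ≤ M)
    (hsup : ∀ x, f x ≠ 0 →
      1 + ∫⁻ y, (j x y + j y x) * h y ∂μ ≤ h x * ∫⁻ y, (j x y + j y x) ∂μ) :
    ∫⁻ x, (f x : ℝ≥0∞) ^ 2 ∂μ ≤
      M * ∫⁻ x, ∫⁻ y, j x y * ENNReal.ofReal (((f x : ℝ) - f y) ^ 2) ∂μ ∂μ := by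
  have hj' : Measurable (Function.uncurry fun x y => j y x) := hj.comp measurable_swap
  set k : X → X → ℝ≥0∞ := fun x y => j x y + j y x with hk
  have hkm : Measurable (Function.uncurry k) := hj.add hj'
  have hks : ∀ x y, k x y = k y x := fun x y => add_comm _ _
  have hf1 : Measurable fun p : X × X => (f p.1 : ℝ≥0∞) := (hf.comp measurable_fst).coe_nnreal_ennreal
  have hf2 : Measurable fun p : X × X => (f p.2 : ℝ≥0∞) := (hf.comp measurable_snd).coe_nnreal_ennreal
  have hh1 : Measurable fun p : X × X => h p.1 := hh.comp measurable_fst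
  have hh2 : Measurable fun p : X × X => h p.2 := hh.comp measurable_snd
  have hΔ : Measurable fun p : X × X => ENNReal.ofReal (((f p.1 : ℝ) - f p.2) ^ 2) :=
    (((hf.comp measurable_fst).coe_nnreal_real.sub
      (hf.comp measurable_snd).coe_nnreal_real).pow_const 2).ennreal_ofReal
  have hh0 : ∀ x, f x ≠ 0 → h x ≠ 0 ∧ h x ≠ ∞ := by
    refine fun x hx => ⟨fun h0 => ?_, ne_top_of_le_ne_top hM (hhM x hx)⟩
    have := (le_self_add.trans (hsup x hx))
    simp [h0] at this
  -- The scheme is `I = J + D`, `J ≤ L` and `M⁻¹ ∫ f² + L ≤ I`, whence `M⁻¹ ∫ f² ≤ D`. Symmetrising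
  -- in `x, y` yields the first two in doubled form, and sums replace the truncated differences of
  -- `ℝ≥0∞`.
  set I := ∫⁻ x, ∫⁻ y, k x y * (f x : ℝ≥0∞) ^ 2 ∂μ ∂μ with hI
  set J := ∫⁻ x, ∫⁻ y, k x y * ((f x : ℝ≥0∞) * f y) ∂μ ∂μ with hJ
  set L := ∫⁻ x, ∫⁻ y, k x y * ((f x : ℝ≥0∞) ^ 2 * (h y / h x)) ∂μ ∂μ with hL
  set D := ∫⁻ x, ∫⁻ y, j x y * ENNReal.ofReal (((f x : ℝ) - f y) ^ 2) ∂μ ∂μ with hD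
  have hI' : I = ∫⁻ x, ∫⁻ y, k x y * (f y : ℝ≥0∞) ^ 2 ∂μ ∂μ := by
    rw [hI, lintegral_lintegral_swap (hkm.mul (hf1.pow_const 2)).aemeasurable]
    simp only [hks]
  have hL' : L = ∫⁻ x, ∫⁻ y, k x y * ((f y : ℝ≥0∞) ^ 2 * (h x / h y)) ∂μ ∂μ := by
    rw [hL, lintegral_lintegral_swap
      (hkm.mul ((hf1.pow_const 2).mul (hh2.div hh1))).aemeasurable]
    simp only [hks]
  have hD' : D = ∫⁻ x, ∫⁻ y, j y x * ENNReal.ofReal (((f x : ℝ) - f y) ^ 2) ∂μ ∂μ := by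
    rw [hD, lintegral_lintegral_swap (hj.mul hΔ).aemeasurable]
    refine lintegral_congr fun x => lintegral_congr fun y => ?_
    congr 2
    ring
  have hmJ : Measurable fun p : X × X => k p.1 p.2 * ((f p.1 : ℝ≥0∞) * f p.2) :=
    hkm.mul (hf1.mul hf2)
  have e1 : I + I = (J + J) + (D + D) := by
    calc I + I = ∫⁻ x, ∫⁻ y, (k x y * (f x : ℝ≥0∞) ^ 2 + k x y * (f y : ℝ≥0∞) ^ 2) ∂μ ∂μ := by
          rw [lintegral_lintegral_add (hkm.mul (hf1.pow_const 2)), ← hI']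
      _ = ∫⁻ x, ∫⁻ y, ((k x y * ((f x : ℝ≥0∞) * f y) + k x y * ((f x : ℝ≥0∞) * f y)) +
            (j x y * ENNReal.ofReal (((f x : ℝ) - f y) ^ 2) +
              j y x * ENNReal.ofReal (((f x : ℝ) - f y) ^ 2))) ∂μ ∂μ := by
          refine lintegral_congr fun x => lintegral_congr fun y => ?_
          rw [← mul_add, sq_add_sq_eq, ← add_mul (j x y), mul_add, two_mul, mul_add]
      _ = _ := by
          rw [lintegral_lintegral_add (hmJ.add hmJ), lintegral_lintegral_add hmJ,
            lintegral_lintegral_add (hj.mul hΔ), ← hD']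
  have e2 : J + J ≤ L + L := by
    calc J + J = ∫⁻ x, ∫⁻ y, (k x y * ((f x : ℝ≥0∞) * f y) + k x y * ((f x : ℝ≥0∞) * f y)) ∂μ ∂μ :=
          (lintegral_lintegral_add hmJ).symm
      _ ≤ ∫⁻ x, ∫⁻ y, (k x y * ((f x : ℝ≥0∞) ^ 2 * (h y / h x)) +
            k x y * ((f y : ℝ≥0∞) ^ 2 * (h x / h y))) ∂μ ∂μ := by
          refine lintegral_mono fun x => lintegral_mono fun y => ?_
          dsimp only
          rw [← mul_add (k x y) (_ ^ 2 * _), ← two_mul, mul_left_comm]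
          exact mul_le_mul_right (two_mul_le_ground_state (hh0 x) (hh0 y)) _
      _ = L + L := by
          rw [lintegral_lintegral_add (hkm.mul ((hf1.pow_const 2).mul (hh2.div hh1))), ← hL']
  -- The supersolution inequality is multiplied by `f² / h` and integrated, with `M⁻¹ ≤ h⁻¹` on the
  -- support of `f`.
  have e3 : M⁻¹ * ∫⁻ x, (f x : ℝ≥0∞) ^ 2 ∂μ + L ≤ I := by
    rw [← lintegral_const_mul _ (hf.coe_nnreal_ennreal.pow_const 2), hL, hI,
      ← lintegral_add_left ((hf.coe_nnreal_ennreal.pow_const 2).const_mul _)]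
    refine lintegral_mono fun x => ?_
    dsimp only
    have hkx : Measurable (k x) := hkm.comp measurable_prodMk_left
    by_cases hx : f x = 0
    · simp [hx]
    obtain ⟨h0, ht⟩ := hh0 x hx
    have hl : ∫⁻ y, k x y * ((f x : ℝ≥0∞) ^ 2 * (h y / h x)) ∂μ =
        (f x : ℝ≥0∞) ^ 2 * ((h x)⁻¹ * ∫⁻ y, k x y * h y ∂μ) := by
      have hkh : Measurable fun y => k x y * h y := hkx.mul hh
      rw [← lintegral_const_mul _ hkh, ← lintegral_const_mul _ (hkh.const_mul _)]
      refine lintegral_congr fun y => ?_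
      rw [div_eq_mul_inv]
      ring
    rw [hl, lintegral_mul_const _ hkx, mul_comm M⁻¹, ← mul_add, mul_comm _ ((f x : ℝ≥0∞) ^ 2)]
    gcongr
    calc M⁻¹ + (h x)⁻¹ * ∫⁻ y, k x y * h y ∂μ
        ≤ (h x)⁻¹ * 1 + (h x)⁻¹ * ∫⁻ y, k x y * h y ∂μ := by
          rw [mul_one]
          gcongr
          exact hhM x hx
      _ = (h x)⁻¹ * (1 + ∫⁻ y, k x y * h y ∂μ) := (mul_add _ _ _).symm
      _ ≤ (h x)⁻¹ * (h x * ∫⁻ y, k x y ∂μ) := by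
          gcongr
          exact hsup x hx
      _ = ∫⁻ y, k x y ∂μ := by rw [← mul_assoc, ENNReal.inv_mul_cancel h0 ht, one_mul]
  -- Boundedness of `j` and `f` enters here: `J + J` must be finite to be cancelled.
  have hIt : I ≠ ∞ := by
    have : I ≤ ∫⁻ _, ∫⁻ _, (c + c) * (b : ℝ≥0∞) ^ 2 ∂μ ∂μ := by
      refine lintegral_mono fun x => lintegral_mono fun y => ?_
      exact mul_le_mul' (add_le_add (hjc _ _) (hjc _ _))
        (pow_le_pow_left' (ENNReal.coe_le_coe.2 (hfb x)) 2)
    refine ne_top_of_le_ne_top ?_ this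
    simp only [lintegral_const]
    finiteness
  have hJt : J + J ≠ ∞ := ne_top_of_le_ne_top (ENNReal.add_ne_top.2 ⟨hIt, hIt⟩) (e1 ▸ le_self_add)
  set Q := M⁻¹ * ∫⁻ x, (f x : ℝ≥0∞) ^ 2 ∂μ with hQ
  have e4 : (J + J) + (Q + Q) ≤ (J + J) + (D + D) := by
    calc (J + J) + (Q + Q) ≤ (L + L) + (Q + Q) := by gcongr
      _ = (Q + L) + (Q + L) := by ring
      _ ≤ I + I := by gcongr
      _ = _ := e1
  have e5 : Q ≤ D := by
    have := (ENNReal.add_le_add_iff_left hJt).1 e4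
    rw [← two_mul, ← two_mul] at this
    exact (ENNReal.mul_le_mul_iff_right two_ne_zero ENNReal.ofNat_ne_top).1 this
  by_cases hM0 : M = 0
  · have : ∀ x, f x = 0 := by
      intro x
      by_contra hx
      exact (hh0 x hx).1 (le_zero_iff.1 (hM0 ▸ hhM x hx))
    simp [this]
  calc ∫⁻ x, (f x : ℝ≥0∞) ^ 2 ∂μ = M * Q := by
        rw [hQ, ← mul_assoc, ENNReal.mul_inv_cancel hM0 hM, one_mul]
    _ ≤ M * D := by gcongr

end GroundState

/-! ### The renormalised walk -/

theorem measurable_exponentialPDF (r : ℝ) : Measurable (exponentialPDF r) :=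
  (measurable_exponentialPDFReal r).ennreal_ofReal

/-- The integrand is `τ` times the density of the Gamma law with shape `2` and rate `τ⁻¹`, which has
mass one. -/
theorem lintegral_exponentialPDF_mul_self {τ : ℝ} (hτ : 0 < τ) :
    ∫⁻ t, exponentialPDF τ⁻¹ t * ENNReal.ofReal t = ENNReal.ofReal τ := by
  have h : ∀ t, exponentialPDF τ⁻¹ t * ENNReal.ofReal t = ENNReal.ofReal τ * gammaPDF 2 τ⁻¹ t := by
    intro t
    rcases lt_or_ge t 0 with ht | ht
    · rw [exponentialPDF_of_neg ht, gammaPDF_of_neg ht, zero_mul, mul_zero]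
    · rw [exponentialPDF_of_nonneg ht, gammaPDF_of_nonneg ht, ← ENNReal.ofReal_mul hτ.le,
        ← ENNReal.ofReal_mul (by positivity)]
      congr 1
      rw [show (2 : ℝ) - 1 = 1 by norm_num, Real.Gamma_two, Real.rpow_one, Real.rpow_two]
      field_simp
  simp_rw [h]
  rw [lintegral_const_mul' _ _ ENNReal.ofReal_ne_top,
    lintegral_gammaPDF_eq_one two_pos (inv_pos.2 hτ), mul_one]

theorem waitTime_pos {X : Type*} (β : X → ℝ≥0) {r : ℝ} (hr : 0 < r) (x : X) :
    0 < waitTime β r x :=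
  Real.rpow_pos_of_pos hr _

theorem measurable_waitTime {X : Type*} [MeasurableSpace X] {β : X → ℝ≥0} (hβ : Measurable β)
    (r : ℝ) : Measurable (waitTime β r) :=
  measurable_const.pow (measurable_coe_nnreal_real.comp hβ)

variable {X : Type*} [MetricSpace X] [MeasurableSpace X] [BorelSpace X] [CompactSpace X]
  (μ : Measure X)

theorem measurable_timeVol {β : X → ℝ≥0} (hβ : Measurable β) (r : ℝ) :
    Measurable (timeVol μ β r) :=
  (measurable_vol μ r).mul (measurable_waitTime hβ r).ennreal_ofReal

/-- On a compact space the upper semicontinuous `β` attains a maximum, so `r ^ β` stays away from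
`0`. This makes the jump density bounded for each fixed `r`. -/
theorem exists_le_timeVol [μ.IsOpenPosMeasure] {β : X → ℝ≥0}
    (hβ : UpperSemicontinuous fun x => (β x : ℝ≥0∞)) {r : ℝ} (hr : 0 < r) :
    ∃ c : ℝ≥0∞, c ≠ 0 ∧ ∀ x, c ≤ timeVol μ β r x := by
  obtain ⟨c, hc, hcv⟩ := exists_le_vol μ hr
  rcases isEmpty_or_nonempty X with h | h
  · exact ⟨1, one_ne_zero, fun x => h.elim x⟩
  obtain ⟨a, -, ha⟩ := (hβ.upperSemicontinuousOn univ).exists_isMaxOn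
    univ_nonempty isCompact_univ
  have hM : ∀ x, (β x : ℝ) ≤ β a := fun x => by
    have h1 : (β x : ℝ≥0∞) ≤ β a := ha (mem_univ x)
    exact_mod_cast h1
  refine ⟨c * ENNReal.ofReal (min 1 (r ^ (β a : ℝ))),
    mul_ne_zero hc (ENNReal.ofReal_pos.2 (lt_min one_pos (Real.rpow_pos_of_pos hr _))).ne',
    fun x => mul_le_mul' (hcv x) (ENNReal.ofReal_le_ofReal ?_)⟩
  rcases le_total r 1 with h1 | h1
  · exact (min_le_right _ _).trans (Real.rpow_le_rpow_of_exponent_ge hr h1 (hM x))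
  · exact (min_le_left _ _).trans (Real.one_le_rpow h1 (β x).2)

/-- Half of the symmetric jump density `χ_{d(x, y) < r} (1 / d_r(x) + 1 / d_r(y))`. -/
def jumpDensity (β : X → ℝ≥0) (r : ℝ) (x y : X) : ℝ≥0∞ :=
  (Metric.ball x r).indicator (fun _ => (timeVol μ β r x)⁻¹) y

theorem measurable_jumpDensity {β : X → ℝ≥0} (hβ : Measurable β) (r : ℝ) :
    Measurable (Function.uncurry (jumpDensity μ β r)) := by
  have hs : MeasurableSet {p : X × X | p.2 ∈ Metric.ball p.1 r} :=
    measurableSet_lt (measurable_snd.dist measurable_fst) measurable_const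
  exact ((measurable_timeVol μ hβ r).comp measurable_fst).inv.indicator hs

variable [IsFiniteMeasure μ]

theorem upperSemicontinuous_of_localTimeExponent {β : X → ℝ≥0}
    (hβ : ∀ x, localTimeExponent μ x = β x) : UpperSemicontinuous fun x => (β x : ℝ≥0∞) := by
  have := upperSemicontinuous_localTimeExponent μ
  rwa [show localTimeExponent μ = fun x => (β x : ℝ≥0∞) from funext hβ] at this

theorem measurable_of_localTimeExponent {β : X → ℝ≥0}
    (hβ : ∀ x, localTimeExponent μ x = β x) : Measurable β :=
  measurable_coe_nnreal_ennreal_iff.1 (upperSemicontinuous_of_localTimeExponent μ hβ).measurable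

theorem lintegral_jumpKernel {β : X → ℝ≥0} (hβ : Measurable β) (r : ℝ) {F : ℝ → ℝ≥0∞}
    (hF : Measurable F) {g : X → ℝ≥0∞} (hg : Measurable g) (a : ℝ × X) :
    ∫⁻ b, F b.1 * g b.2 ∂jumpKernel μ β r a =
      (∫⁻ t, exponentialPDF (waitTime β r a.2)⁻¹ t * F t) *
        ∫⁻ y, stepDensity μ r (timeVol μ β r) a.2 y * g y ∂μ := by
  have hem : Measurable fun q : ℝ × ℝ => exponentialPDF q.1 q.2 := by
    simp_rw [exponentialPDF_eq]
    refine Measurable.ennreal_ofReal (Measurable.ite ?_ ?_ measurable_const)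
    · exact measurableSet_le measurable_const measurable_snd
    · fun_prop
  have hwm := measurable_waitTime hβ r
  have hsm := measurable_stepDensity μ r (measurable_timeVol μ hβ r)
  have h1 : Measurable fun p : (ℝ × X) × ℝ × X => exponentialPDF (waitTime β r p.1.2)⁻¹ p.2.1 :=
    hem.comp (f := fun p : (ℝ × X) × ℝ × X => ((waitTime β r p.1.2)⁻¹, p.2.1)) (by fun_prop)
  have h2 : Measurable fun p : (ℝ × X) × ℝ × X =>
      stepDensity μ r (timeVol μ β r) p.1.2 p.2.2 :=
    hsm.comp (f := fun p : (ℝ × X) × ℝ × X => (p.1.2, p.2.2)) (by fun_prop)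
  have h3 : Measurable fun y => stepDensity μ r (timeVol μ β r) a.2 y :=
    hsm.of_uncurry_left
  have h12 : Measurable (Function.uncurry fun a b : ℝ × X =>
      exponentialPDF (waitTime β r a.2)⁻¹ b.1 * stepDensity μ r (timeVol μ β r) a.2 b.2) :=
    h1.mul h2
  have hFg : Measurable fun b : ℝ × X => F b.1 * g b.2 :=
    (hF.comp measurable_fst).mul (hg.comp measurable_snd)
  have h5 := lintegral_prod_mul (μ := (volume : Measure ℝ)) (ν := μ)
    ((measurable_exponentialPDF (waitTime β r a.2)⁻¹).mul hF).aemeasurable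
    (h3.mul hg).aemeasurable
  have h6 := Kernel.lintegral_withDensity (Kernel.const (ℝ × X) ((volume : Measure ℝ).prod μ))
    h12 a hFg
  rw [Kernel.const_apply] at h6
  refine h6.trans (Eq.trans (lintegral_congr fun b => ?_) h5)
  exact mul_mul_mul_comm _ _ _ _

/-- The transition operator of the renormalised walk killed when it jumps from a site outside
`A`. -/
def siteOp (β : X → ℝ≥0) (r : ℝ) (A : Set X) (g : X → ℝ≥0∞) (x : X) : ℝ≥0∞ :=
  A.indicator (fun x => ∫⁻ y, stepDensity μ r (timeVol μ β r) x y * g y ∂μ) x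

/-- The Green potential of the waiting time, for the renormalised walk killed outside `A`. -/
def greenTime (β : X → ℝ≥0) (r : ℝ) (A : Set X) (x : X) : ℝ≥0∞ :=
  ∑' j : ℕ, (siteOp μ β r A)^[j] (A.indicator fun x => ENNReal.ofReal (waitTime β r x)) x

theorem measurable_siteOp {β : X → ℝ≥0} (hβ : Measurable β) (r : ℝ) {A : Set X}
    (hA : MeasurableSet A) {g : X → ℝ≥0∞} (hg : Measurable g) :
    Measurable (siteOp μ β r A g) := by
  have h : Measurable fun p : X × X => stepDensity μ r (timeVol μ β r) p.1 p.2 * g p.2 :=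
    (measurable_stepDensity μ r (measurable_timeVol μ hβ r)).mul (hg.comp measurable_snd)
  exact Measurable.indicator h.lintegral_prod_right' hA

theorem measurable_iterate_siteOp {β : X → ℝ≥0} (hβ : Measurable β) (r : ℝ) {A : Set X}
    (hA : MeasurableSet A) (j : ℕ) : Measurable
    ((siteOp μ β r A)^[j] (A.indicator fun x => ENNReal.ofReal (waitTime β r x))) := by
  induction j with
  | zero => exact (measurable_waitTime hβ r).ennreal_ofReal.indicator hA
  | succ j ih =>
    rw [Function.iterate_succ_apply']
    exact measurable_siteOp μ hβ r hA ih

theorem measurable_greenTime {β : X → ℝ≥0} (hβ : Measurable β) (r : ℝ) {A : Set X}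
    (hA : MeasurableSet A) : Measurable (greenTime μ β r A) :=
  Measurable.tsum fun j => measurable_iterate_siteOp μ hβ r hA j

/-- The first-step equation `h = τ + P h`, by shifting the Neumann series. It holds in `[0, ∞]`
without any convergence assumption. -/
theorem greenTime_eq {β : X → ℝ≥0} (hβ : Measurable β) (r : ℝ) {A : Set X}
    (hA : MeasurableSet A) {x : X} (hx : x ∈ A) :
    greenTime μ β r A x = ENNReal.ofReal (waitTime β r x) +
      ∫⁻ y, stepDensity μ r (timeVol μ β r) x y * greenTime μ β r A y ∂μ := by
  have hs : Measurable (stepDensity μ r (timeVol μ β r) x) :=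
    (measurable_stepDensity μ r (measurable_timeVol μ hβ r)).of_uncurry_left
  set τ : X → ℝ≥0∞ := A.indicator fun x => ENNReal.ofReal (waitTime β r x) with hτ
  have h1 : greenTime μ β r A x = τ x + ∑' j, (siteOp μ β r A)^[j + 1] τ x :=
    tsum_eq_zero_add' ENNReal.summable
  have h2 : ∫⁻ y, stepDensity μ r (timeVol μ β r) x y * greenTime μ β r A y ∂μ =
      ∑' j, ∫⁻ y, stepDensity μ r (timeVol μ β r) x y * (siteOp μ β r A)^[j] τ y ∂μ := by
    refine Eq.trans (lintegral_congr fun y => ENNReal.tsum_mul_left.symm) ?_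
    exact lintegral_tsum fun j => (hs.mul (measurable_iterate_siteOp μ hβ r hA j)).aemeasurable
  rw [h1, h2, hτ, indicator_of_mem hx]
  congr 1
  refine tsum_congr fun j => ?_
  rw [Function.iterate_succ_apply', siteOp, indicator_of_mem hx]

/-! ### Green potential and mean exit time -/

theorem killedOp_jumpKernel_site {β : X → ℝ≥0} (hβ : Measurable β) (r : ℝ) {A : Set X}
    (hr : 0 < r) {g : X → ℝ≥0∞} (hg : Measurable g) :
    killedOp (jumpKernel μ β r) (Prod.snd ⁻¹' A) (fun a => g a.2) =
      fun a => siteOp μ β r A g a.2 := by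
  funext a
  have h := lintegral_jumpKernel μ hβ r (F := 1) measurable_one hg a
  simp only [Pi.one_apply, one_mul, mul_one,
    lintegral_exponentialPDF_eq_one (inv_pos.2 (waitTime_pos β hr _))] at h
  by_cases ha : a.2 ∈ A <;> simp [killedOp, siteOp, ha, h]

theorem iterate_killedOp_jumpKernel_site {β : X → ℝ≥0} (hβ : Measurable β) (r : ℝ) {A : Set X}
    (hA : MeasurableSet A) (hr : 0 < r) (j : ℕ) {g : X → ℝ≥0∞}
    (hg : Measurable g) :
    (killedOp (jumpKernel μ β r) (Prod.snd ⁻¹' A))^[j] (fun a => g a.2) =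
      fun a => (siteOp μ β r A)^[j] g a.2 := by
  induction j generalizing g with
  | zero => rfl
  | succ j ih =>
    rw [Function.iterate_succ_apply, Function.iterate_succ_apply,
      killedOp_jumpKernel_site μ hβ r hr hg, ih (measurable_siteOp μ hβ r hA hg)]

/-- The operator applied first averages the exponential waiting time to its mean `τ_r` at the site
being left; the other `j` see only sites. -/
theorem iterate_killedOp_jumpKernel_time {β : X → ℝ≥0} (hβ : Measurable β) (r : ℝ) {A : Set X}
    (hA : MeasurableSet A) [μ.IsOpenPosMeasure] (hr : 0 < r)
    [IsMarkovKernel (jumpKernel μ β r)] (j : ℕ) :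
    (killedOp (jumpKernel μ β r) (Prod.snd ⁻¹' A))^[j + 1] (fun a => ENNReal.ofReal a.1) =
      fun a => (siteOp μ β r A)^[j] (A.indicator fun x => ENNReal.ofReal (waitTime β r x)) a.2 := by
  rw [Function.iterate_succ_apply, ← iterate_killedOp_jumpKernel_site μ hβ r hA hr j
    ((measurable_waitTime hβ r).ennreal_ofReal.indicator hA)]
  congr 1
  funext a
  have h := lintegral_jumpKernel μ hβ r ENNReal.measurable_ofReal (g := 1) measurable_one a
  -- Total mass one of the Markov kernel forces the step density to have integral one.
  have h1 := lintegral_jumpKernel μ hβ r (F := 1) measurable_one (g := 1) measurable_one a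
  simp only [Pi.one_apply, one_mul, mul_one, lintegral_one, measure_univ,
    lintegral_exponentialPDF_eq_one (inv_pos.2 (waitTime_pos β hr _))] at h1
  simp only [Pi.one_apply, mul_one, ← h1,
    lintegral_exponentialPDF_mul_self (waitTime_pos β hr _)] at h
  by_cases ha : a.2 ∈ A <;> simp [killedOp, ha, h]

theorem jumpKernel_negative_time {β : X → ℝ≥0} (hβ : Measurable β) (r : ℝ) (a : ℝ × X) :
    jumpKernel μ β r a {b | b.1 < 0} = 0 := by
  have hs : MeasurableSet {b : ℝ × X | b.1 < 0} := measurableSet_lt measurable_fst measurable_const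
  have h := lintegral_jumpKernel μ hβ r (F := (Iio 0).indicator 1)
    (measurable_one.indicator measurableSet_Iio) (g := 1) measurable_one a
  have h0 : ∀ t, exponentialPDF (waitTime β r a.2)⁻¹ t * (Iio (0 : ℝ)).indicator 1 t = 0 := by
    intro t
    rcases lt_or_ge t 0 with ht | ht
    · rw [exponentialPDF_of_neg ht, zero_mul]
    · rw [indicator_of_notMem (by simpa using ht), mul_zero]
  simp only [h0, lintegral_zero, zero_mul, Pi.one_apply, mul_one] at h
  rw [← lintegral_indicator_one hs, ← h]
  refine lintegral_congr fun b => ?_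
  by_cases hb : b.1 < 0 <;> simp [hb]

/-- The potential is the expectation of the series of holding times in `tsum_le_jumpExitTime`, whose
nonnegativity hypothesis holds almost surely. -/
theorem greenTime_le_meanJumpExit {β : X → ℝ≥0} (hβ : Measurable β) (r : ℝ) {A : Set X}
    (hA : MeasurableSet A) [μ.IsOpenPosMeasure] (hr : 0 < r)
    [IsMarkovKernel (jumpKernel μ β r)] (x : X) :
    greenTime μ β r A x ≤ meanJumpExit μ β r A x := by
  have hs : MeasurableSet {b : ℝ × X | b.1 < 0} := measurableSet_lt measurable_fst measurable_const
  have hA' : MeasurableSet (Prod.snd ⁻¹' A : Set (ℝ × X)) := measurable_snd hA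
  have hT : Measurable fun a : ℝ × X => ENNReal.ofReal a.1 := measurable_fst.ennreal_ofReal
  have hω : ∀ᵐ ω ∂pathLaw (jumpKernel μ β r) (0, x), ∀ j, 0 ≤ (ω j).1 := by
    rw [ae_all_iff]
    intro j
    cases j with
    | zero =>
      filter_upwards [ae_pathLaw_zero (jumpKernel μ β r) ((0 : ℝ), x) hs (by simp)] with ω h
      simpa using h
    | succ j =>
      filter_upwards [ae_pathLaw_succ (jumpKernel μ β r) (0, x) hs
        (jumpKernel_negative_time μ hβ r) j] with ω h
      simpa using h
  have hm : ∀ j : ℕ, Measurable fun ω : ℕ → ℝ × X =>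
      (∏ i ∈ Finset.range (j + 1), (Prod.snd ⁻¹' A).indicator (1 : ℝ × X → ℝ≥0∞) (ω i)) *
        ENNReal.ofReal (ω (j + 1)).1 := fun j =>
    (Finset.measurable_prod _ fun i _ =>
      (measurable_one.indicator hA').comp (measurable_pi_apply i)).mul
      (hT.comp (measurable_pi_apply (j + 1)))
  calc greenTime μ β r A x = ∫⁻ ω, ∑' j, (∏ i ∈ Finset.range (j + 1),
          (Prod.snd ⁻¹' A).indicator 1 (ω i)) * ENNReal.ofReal (ω (j + 1)).1
            ∂pathLaw (jumpKernel μ β r) (0, x) := by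
        rw [lintegral_tsum fun j => (hm j).aemeasurable]
        refine tsum_congr fun j => ?_
        rw [lintegral_pathLaw_killed (jumpKernel μ β r) hA' (0, x) (j + 1) hT,
          iterate_killedOp_jumpKernel_time μ hβ r hA hr j]
    _ ≤ _ := lintegral_mono_ae (hω.mono fun ω h => tsum_le_jumpExitTime A h)

/-! ### The jump form of the renormalised walk -/

variable [μ.IsOpenPosMeasure]

/-- The reason for the weight `d_r = v_r τ_r`: up to the factor `τ_r(x)`, the unnormalised step
density is symmetric. -/
theorem inv_vol_mul_indicator (β : X → ℝ≥0) {r : ℝ} (hr : 0 < r) (x y : X) :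
    (vol μ r x)⁻¹ * (Metric.ball x r).indicator
        (fun y => 1 + timeVol μ β r x / timeVol μ β r y) y =
      ENNReal.ofReal (waitTime β r x) * (jumpDensity μ β r x y + jumpDensity μ β r y x) := by
  have hv0 := (vol_pos μ hr x).ne'
  have hvt := (vol_lt_top μ r x).ne
  have hw0 := (ENNReal.ofReal_pos.2 (waitTime_pos β hr x)).ne'
  have hwt : ENNReal.ofReal (waitTime β r x) ≠ ∞ := ENNReal.ofReal_ne_top
  by_cases hy : y ∈ Metric.ball x r
  · rw [jumpDensity, jumpDensity, indicator_of_mem hy, indicator_of_mem hy,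
      indicator_of_mem (Metric.mem_ball_comm.1 hy), mul_add, mul_add, mul_one]
    congr 1
    · rw [timeVol, ENNReal.mul_inv (Or.inl hv0) (Or.inl hvt), mul_left_comm,
        ENNReal.mul_inv_cancel hw0 hwt, mul_one]
    · rw [div_eq_mul_inv, ← mul_assoc]
      congr 1
      rw [timeVol, ← mul_assoc, ENNReal.inv_mul_cancel hv0 hvt, one_mul]
  · rw [jumpDensity, jumpDensity, indicator_of_notMem hy, indicator_of_notMem hy,
      indicator_of_notMem fun h => hy (Metric.mem_ball_comm.1 h)]
    simp

theorem one_le_stepNorm {r : ℝ} (hr : 0 < r) (g : X → ℝ≥0∞) (x : X) : 1 ≤ stepNorm μ r g x := by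
  calc 1 = (vol μ r x)⁻¹ * ∫⁻ _ in Metric.ball x r, 1 ∂μ := by
        rw [setLIntegral_one]
        exact (ENNReal.inv_mul_cancel (vol_pos μ hr x).ne' (vol_lt_top μ r x).ne).symm
    _ ≤ _ := mul_le_mul_right (lintegral_mono fun y => le_self_add) _

/-- The Green potential of the waiting time is a supersolution of `-L h = 1` on `A`. -/
theorem one_add_le_greenTime_mul {β : X → ℝ≥0}
    (hβ : UpperSemicontinuous fun x => (β x : ℝ≥0∞)) {r : ℝ} (hr : 0 < r) {A : Set X}
    (hA : MeasurableSet A) {x : X} (hx : x ∈ A) :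
    1 + ∫⁻ y, (jumpDensity μ β r x y + jumpDensity μ β r y x) * greenTime μ β r A y ∂μ ≤
      greenTime μ β r A x * ∫⁻ y, (jumpDensity μ β r x y + jumpDensity μ β r y x) ∂μ := by
  have hβm : Measurable β := measurable_coe_nnreal_ennreal_iff.1 hβ.measurable
  obtain ⟨c, hc, hcd⟩ := exists_le_timeVol μ hβ hr
  have hj := measurable_jumpDensity μ hβm r
  have hk : Measurable fun y => jumpDensity μ β r x y + jumpDensity μ β r y x :=
    (hj.comp measurable_prodMk_left).add (hj.comp measurable_prodMk_right)
  have hjc : ∀ x y, jumpDensity μ β r x y ≤ c⁻¹ := fun x y =>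
    (indicator_le_self' (fun _ _ => zero_le) y).trans (ENNReal.inv_le_inv.2 (hcd x))
  set K := ∫⁻ y, (jumpDensity μ β r x y + jumpDensity μ β r y x) ∂μ with hK
  set τ := ENNReal.ofReal (waitTime β r x) with hτ
  have hKt : K ≠ ∞ := by
    have : K ≤ ∫⁻ _, (c⁻¹ + c⁻¹) ∂μ := lintegral_mono fun y => add_le_add (hjc _ _) (hjc _ _)
    refine ne_top_of_le_ne_top ?_ this
    rw [lintegral_const]
    have := ENNReal.inv_ne_top.2 hc
    finiteness
  -- Thus the step density is `k / K`. Multiplying `h = τ + P h` by `K` turns the source into `τ *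
  -- K`, the normalisation, which is at least `1`.
  have hN : stepNorm μ r (timeVol μ β r) x = τ * K := by
    rw [stepNorm, ← lintegral_indicator Metric.isOpen_ball.measurableSet,
      ← lintegral_const_mul' _ _ (ENNReal.inv_ne_top.2 (vol_pos μ hr x).ne'), hK,
      ← lintegral_const_mul _ hk]
    exact lintegral_congr fun y => inv_vol_mul_indicator μ β hr x y
  have hN1 := one_le_stepNorm μ hr (timeVol μ β r) x
  rw [hN] at hN1
  have hN0 : τ * K ≠ 0 := (zero_lt_one.trans_le hN1).ne'
  have hNt : τ * K ≠ ∞ := ENNReal.mul_ne_top ENNReal.ofReal_ne_top hKt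
  have hs : ∀ y, stepDensity μ r (timeVol μ β r) x y * greenTime μ β r A y =
      (τ * K)⁻¹ * τ * ((jumpDensity μ β r x y + jumpDensity μ β r y x) *
        greenTime μ β r A y) := by
    intro y
    rw [stepDensity, mul_assoc _ (vol μ r x)⁻¹, inv_vol_mul_indicator μ β hr x y, hN]
    ring
  rw [greenTime_eq μ hβm r hA hx, add_mul]
  simp_rw [hs]
  have hkg : Measurable fun y => (jumpDensity μ β r x y + jumpDensity μ β r y x) *
      greenTime μ β r A y := hk.mul (measurable_greenTime μ hβm r hA)
  rw [lintegral_const_mul _ hkg]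
  refine add_le_add hN1 (le_of_eq ?_)
  set Y := ∫⁻ y, (jumpDensity μ β r x y + jumpDensity μ β r y x) * greenTime μ β r A y ∂μ
  calc Y = (τ * K)⁻¹ * (τ * K) * Y := by rw [ENNReal.inv_mul_cancel hN0 hNt, one_mul]
    _ = _ := by ring

/-- The energy of a `1`-Lipschitz function which vanishes outside `B_R(a)`. -/
theorem energy_le {β : X → ℝ≥0} {a : X} {R b r : ℝ}
    (hb : ∀ x ∈ Metric.ball a (2 * R), (β x : ℝ) ≤ b) (hr : 0 < r) (hrR : r ≤ R) (hr1 : r ≤ 1)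
    {f : X → ℝ≥0} (hf : LipschitzWith 1 f) (hf0 : ∀ x, R ≤ dist x a → f x = 0) :
    ∫⁻ x, ∫⁻ y, jumpDensity μ β r x y * ENNReal.ofReal (((f x : ℝ) - f y) ^ 2) ∂μ ∂μ ≤
      ENNReal.ofReal (r ^ (2 - b)) * μ univ := by
  rw [← lintegral_const]
  refine lintegral_mono fun x => ?_
  have hv0 := (vol_pos μ hr x).ne'
  have hvt := (vol_lt_top μ r x).ne
  by_cases hx : x ∈ Metric.ball a (2 * R)
  · calc ∫⁻ y, jumpDensity μ β r x y * ENNReal.ofReal (((f x : ℝ) - f y) ^ 2) ∂μ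
        ≤ ∫⁻ y, (Metric.ball x r).indicator
            (fun _ => (timeVol μ β r x)⁻¹ * ENNReal.ofReal (r ^ 2)) y ∂μ := by
          refine lintegral_mono fun y => ?_
          by_cases hy : y ∈ Metric.ball x r
          · rw [jumpDensity, indicator_of_mem hy, indicator_of_mem hy]
            refine mul_le_mul_right (ENNReal.ofReal_le_ofReal ?_) _
            have h1 := hf.dist_le_mul x y
            rw [NNReal.dist_eq, NNReal.coe_one, one_mul] at h1
            rw [← sq_abs]
            exact pow_le_pow_left₀ (abs_nonneg _)
              (h1.trans (Metric.mem_ball'.1 hy).le) 2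
          · rw [jumpDensity, indicator_of_notMem hy, zero_mul]
            exact zero_le
      -- The volume of the ball cancels the one in `d_r`, leaving `r ^ 2 / r ^ β`.
      _ = ENNReal.ofReal (r ^ (2 - (β x : ℝ))) := by
          rw [lintegral_indicator_const Metric.isOpen_ball.measurableSet, timeVol,
            ENNReal.mul_inv (Or.inl hv0) (Or.inl hvt)]
          change (vol μ r x)⁻¹ * _ * _ * vol μ r x = _
          rw [mul_assoc (vol μ r x)⁻¹, mul_right_comm, ENNReal.inv_mul_cancel hv0 hvt, one_mul,
            ← ENNReal.ofReal_inv_of_pos (waitTime_pos β hr x),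
            ← ENNReal.ofReal_mul (inv_nonneg.2 (waitTime_pos β hr x).le), waitTime,
            Real.rpow_sub hr, Real.rpow_two, div_eq_inv_mul]
      _ ≤ ENNReal.ofReal (r ^ (2 - b)) := by
          refine ENNReal.ofReal_le_ofReal (Real.rpow_le_rpow_of_exponent_ge hr hr1 ?_)
          linarith [hb x hx]
  -- From outside `B_{2R}(a)` a jump shorter than `r ≤ R` cannot reach `B_R(a)`, so `f` vanishes at
  -- both ends.
  · refine le_of_eq_of_le ?_ zero_le
    rw [Metric.mem_ball, not_lt] at hx
    have h0 : ∀ y, jumpDensity μ β r x y * ENNReal.ofReal (((f x : ℝ) - f y) ^ 2) = 0 := by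
      intro y
      by_cases hy : y ∈ Metric.ball x r
      · have h1 := dist_triangle x y a
        have h2 := Metric.mem_ball'.1 hy
        rw [hf0 x (by linarith), hf0 y (by linarith)]
        simp
      · rw [jumpDensity, indicator_of_notMem hy, zero_mul]
    simp [h0]

/-- If `β x < 2` near `a`, the energy of a bump function tends to `0` with `r`, so by Barta's
inequality the mean exit times from a small ball blow up. Neither doubling nor the lower bound for
the limit exit times is needed. -/
theorem two_le_of_limitExit_ne_top {β : X → ℝ≥0} (hβ : ∀ x, localTimeExponent μ x = β x) (a : X)
    {R₀ : ℝ} (hR₀ : 0 < R₀)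
    (hfin : ∀ R, 0 < R → R < R₀ → limitExit μ β (Metric.closedBall a R) ≠ ∞) : 2 ≤ β a := by
  by_contra! ha
  obtain ⟨b, hab, hb2⟩ := exists_between ha
  have husc := upperSemicontinuous_of_localTimeExponent μ hβ
  have hβm := measurable_of_localTimeExponent μ hβ
  obtain ⟨ε, hε, hεb⟩ := Metric.eventually_nhds_iff_ball.1
    (husc a b (ENNReal.coe_lt_coe.2 hab))
  obtain ⟨R, hR, hRε⟩ : ∃ R, 0 < R ∧ R < min (ε / 2) R₀ :=
    exists_between (lt_min (half_pos hε) hR₀)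
  have hR1 : 2 * R ≤ ε := by linarith [hRε.trans_le (min_le_left _ _)]
  have hbR : ∀ x ∈ Metric.ball a (2 * R), (β x : ℝ) ≤ b := fun x hx =>
    NNReal.coe_le_coe.2 (ENNReal.coe_lt_coe.1 (hεb x (Metric.ball_subset_ball hR1 hx))).le
  have hT := hfin R hR (hRε.trans_le (min_le_right _ _))
  set A := Metric.closedBall a R with hA
  have hAm : MeasurableSet A := Metric.isClosed_closedBall.measurableSet
  set f : X → ℝ≥0 := fun x => Real.toNNReal (R - dist x a) with hf
  have hflip : LipschitzWith 1 f := by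
    refine LipschitzWith.of_dist_le_mul fun x y => ?_
    rw [NNReal.coe_one, one_mul, NNReal.dist_eq, hf]
    simp only [Real.coe_toNNReal']
    refine (abs_max_sub_max_le_abs _ _ _).trans ?_
    rw [show R - dist x a - (R - dist y a) = dist y a - dist x a by ring, dist_comm x y]
    exact abs_dist_sub_le y x a
  have hf0 : ∀ x, R ≤ dist x a → f x = 0 := fun x hx => Real.toNNReal_of_nonpos (by linarith)
  have hfA : ∀ x, f x ≠ 0 → x ∈ A := fun x hx =>
    Metric.mem_closedBall.2 (not_lt.1 fun h => hx (hf0 x h.le))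
  have hfb : ∀ x, f x ≤ Real.toNNReal R := fun x =>
    Real.toNNReal_mono (by linarith [dist_nonneg (x := x) (y := a)])
  -- A finite bound strictly above the limsup dominates the mean exit times for all small `r`.
  obtain ⟨M, hM, hMt⟩ := exists_between (lt_top_iff_ne_top.2 hT)
  have hev : ∀ᶠ r in 𝓝[>] (0 : ℝ), ∫⁻ x, (f x : ℝ≥0∞) ^ 2 ∂μ ≤
      M * (ENNReal.ofReal (r ^ (2 - (b : ℝ))) * μ univ) := by
    filter_upwards [eventually_lt_of_limsup_lt hM, self_mem_nhdsWithin,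
      Ioc_mem_nhdsGT hR, Ioc_mem_nhdsGT one_pos] with r hrM hr hrR hr1
    have hr : 0 < r := hr
    have := isMarkovKernel_jumpKernel μ hβ hr
    obtain ⟨c, hc, hcd⟩ := exists_le_timeVol μ husc hr
    refine (lintegral_sq_le_mul_energy (measurable_jumpDensity μ hβm r)
      (ENNReal.inv_ne_top.2 hc)
      (fun x y => (indicator_le_self' (fun _ _ => zero_le) y).trans
        (ENNReal.inv_le_inv.2 (hcd x)))
      hflip.continuous.measurable hfb (measurable_greenTime μ hβm r hAm) hMt.ne ?_
      fun x hx => one_add_le_greenTime_mul μ husc hr hAm (hfA x hx)).trans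
      (mul_le_mul_right (energy_le μ hbR hr hrR.2 hr1.2 hflip hf0) _)
    intro x hx
    refine (greenTime_le_meanJumpExit μ hβm r hAm hr x).trans (le_trans ?_ hrM.le)
    exact le_iSup₂ (f := fun y (_ : y ∈ A) => meanJumpExit μ β r A y) x (hfA x hx)
  have hlim : Tendsto (fun r : ℝ => M * (ENNReal.ofReal (r ^ (2 - (b : ℝ))) * μ univ))
      (𝓝[>] 0) (𝓝 0) := by
    have hb : (0 : ℝ) < 2 - b := sub_pos.2 (by exact_mod_cast hb2)
    have h1 : Tendsto (fun r : ℝ => ENNReal.ofReal (r ^ (2 - (b : ℝ)))) (𝓝[>] 0) (𝓝 0) := by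
      have := ENNReal.tendsto_ofReal ((Real.continuousAt_rpow_const 0 (2 - (b : ℝ))
        (Or.inr hb.le)).tendsto.mono_left (nhdsWithin_le_nhds (s := Ioi 0)))
      rwa [Real.zero_rpow hb.ne', ENNReal.ofReal_zero] at this
    have h2 := ENNReal.Tendsto.mul_const (b := μ univ) h1 (Or.inr (measure_ne_top μ univ))
    have h3 := ENNReal.Tendsto.const_mul (a := M) h2 (Or.inr hMt.ne)
    simpa using h3
  have hzero := le_zero_iff.1 (ge_of_tendsto hlim hev)
  have hfm := hflip.continuous.measurable.coe_nnreal_ennreal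
  rw [lintegral_eq_zero_iff (hfm.pow_const 2)] at hzero
  have hae : f =ᵐ[μ] fun _ => 0 := by
    filter_upwards [hzero] with x hx
    simpa using hx
  -- Full support upgrades almost everywhere equality of continuous functions to equality,
  -- contradicting `f a = R > 0`.
  have := congrFun ((hflip.continuous.ae_eq_iff_eq μ continuous_const).1 hae) a
  simp [hf, hR.not_ge] at this

end

end TimeExponent

theorem mainTheorem4 {X : Type*} [MetricSpace X] [CompactSpace X] [ConnectedSpace X] [Nontrivial X]
    [MeasurableSpace X] [BorelSpace X] (μ : MeasureTheory.Measure X)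
    [MeasureTheory.IsFiniteMeasure μ] [μ.IsOpenPosMeasure] (hμ : TimeExponent.IsDoubling μ)
    (β : X → ℝ≥0) (hβ : TimeExponent.IsVariableTimeRegular μ β) :
    ∀ x : X, 2 ≤ β x := by
  intro x
  obtain ⟨hloc, C, -, hC⟩ := hβ
  have hdiam : 0 < Metric.diam (univ : Set X) :=
    Metric.diam_pos nontrivial_univ isCompact_univ.isBounded
  exact TimeExponent.two_le_of_limitExit_ne_top μ hloc x (half_pos hdiam) fun R hR hR' =>
    ne_top_of_le_ne_top ENNReal.ofReal_ne_top (hC x R hR hR').2
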